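/- Let $n\ge 0$ and let $D\subset\mathbb P^n=\mathbb P^n_{\mathbb C}$ be a set of $n+2$ distinct points in general position, i.e. any $n+1$ of them are linearly independent. Then: (i) $D$ is GIT stable: viewed as a point $x$ of $(\mathbb P^n)^{D}$ (one factor for each point of $D$), with the diagonal action of $SL_{n+1}(\mathbb C)$ linearized by $\mathcal O(1,\dots,1)$, some $SL_{n+1}(\mathbb C)$-invariant section of $\mathcal O(k,\dots,k)$ with $k>0$ does not vanish at $x$ (i.e. $x$ is semistable), the orbit of $x$ is closed in the semistable locus, and the stabilizer of $x$ in $SL_{n+1}(\mathbb C)$ is finite. (ii) $D$ admits a balanced embedding: there are $g\in GL_{n+1}(\mathbb C)$ and $\lambda\in\mathbb C$ such that $$\Big(\sum_{[z]\in gD}\frac{z_i\bar z_j}{|z|^2}\Big)_{0\le i,j\le n}=\lambda\,\mathrm{Id}.$$ More precisely, $g$ can be chosen such that $gD=\{v_0,\dots,v_{n+1}\}$, where $v_b=[1:\zeta^b:\zeta^{2b}:\dots:\zeta^{nb}]$ and $\zeta=e^{2\pi i/(n+2)}$, and then this matrix equals $\frac{n+2}{n+1}\,\mathrm{Id}$.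 -/

import Mathlib

open scoped LinearAlgebra.Projectivization MatrixGroups ComplexConjugate

noncomputable section

namespace PointSets

/-- Complex projective space `ℙⁿ`. Mathlib's actions of `GL (Fin (n+1)) ℂ` and `SL(n+1, ℂ)` on it
are the ones induced by matrix-vector multiplication. -/
abbrev ProjSpace (n : ℕ) : Type := ℙ ℂ (Fin (n + 1) → ℂ)

/-- `n + 2` points of `ℙⁿ` are in general position if any `n + 1` of them are linearly
independent. -/
def InGeneralPosition {n : ℕ} (D : Finset (ProjSpace n)) : Prop :=
  ∀ s ⊆ D, s.card = n + 1 → Projectivization.Independent (fun p : s => (p : ProjSpace n))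

/-- The image `g D` of a finite point set under a projective transformation. -/
def translate {n : ℕ} (g : GL (Fin (n + 1)) ℂ) (D : Finset (ProjSpace n)) :
    Finset (ProjSpace n) :=
  D.map (MulAction.toPerm g).toEmbedding

/-! ### GIT stability of point sets

The group `SL(n+1, ℂ)` acts diagonally on `(ℙⁿ)^ι`, with the symmetric linearization
`𝒪(1, …, 1)`. -/

section GIT

variable {n : ℕ} {ι : Type*} [Fintype ι]

/-- Polynomials in the homogeneous coordinates of `ι` points of `ℙⁿ` that are homogeneous of degree
`d i` in the coordinates of the `i`-th point, i.e. sections of `𝒪(d)` on `(ℙⁿ)^ι`.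
(As `ℂ` is infinite, homogeneity can be tested on values.) -/
def IsMultihomogeneous (f : MvPolynomial (ι × Fin (n + 1)) ℂ) (d : ι → ℕ) : Prop :=
  ∀ (t : ι → ℂ) (v : ι × Fin (n + 1) → ℂ),
    MvPolynomial.eval (fun p => t p.1 * v p) f = (∏ i, t i ^ d i) * MvPolynomial.eval v f

/-- Vanishing of a multihomogeneous polynomial at a point of `(ℙⁿ)^ι`, tested on
representatives. -/
def VanishesAt (f : MvPolynomial (ι × Fin (n + 1)) ℂ) (x : ι → ProjSpace n) : Prop :=
  MvPolynomial.eval (fun p => (x p.1).rep p.2) f = 0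

/-- Vanishing does not depend on the representatives. -/
theorem vanishesAt_mk_iff {f : MvPolynomial (ι × Fin (n + 1)) ℂ} {d : ι → ℕ}
    (hf : IsMultihomogeneous f d) (v : ι → Fin (n + 1) → ℂ) (hv : ∀ i, v i ≠ 0) :
    VanishesAt f (fun i => Projectivization.mk ℂ (v i) (hv i)) ↔
      MvPolynomial.eval (fun p => v p.1 p.2) f = 0 := by
  choose a ha using fun i => Projectivization.exists_smul_eq_mk_rep ℂ (v i) (hv i)
  have h := hf (fun i => (a i : ℂ)) (fun p => v p.1 p.2)
  have h2 : (fun p : ι × Fin (n + 1) => (Projectivization.mk ℂ (v p.1) (hv p.1)).rep p.2) =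
      fun p => (a p.1 : ℂ) * v p.1 p.2 := by
    funext p
    rw [← ha p.1]
    rfl
  have h3 : (∏ i, (a i : ℂ) ^ d i) ≠ 0 :=
    Finset.prod_ne_zero_iff.mpr fun i _ => pow_ne_zero _ (a i).ne_zero
  unfold VanishesAt
  rw [h2, h]
  simp [h3]

/-- The Zariski closure of a subset of `(ℙⁿ)^ι`. -/
def zariskiClosure (S : Set (ι → ProjSpace n)) : Set (ι → ProjSpace n) :=
  {y | ∀ (f : MvPolynomial (ι × Fin (n + 1)) ℂ) (d : ι → ℕ), IsMultihomogeneous f d →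
    (∀ x ∈ S, VanishesAt f x) → VanishesAt f y}

/-- Invariance of a polynomial under the diagonal action of `SL(n+1, ℂ)`. -/
def IsSLInvariant (f : MvPolynomial (ι × Fin (n + 1)) ℂ) : Prop :=
  ∀ (g : SL(n + 1, ℂ)) (v : ι → Fin (n + 1) → ℂ),
    MvPolynomial.eval (fun p => (g • v p.1) p.2) f = MvPolynomial.eval (fun p => v p.1 p.2) f

/-- The semistable locus: configurations at which some `SL(n+1, ℂ)`-invariant section of
`𝒪(k, …, k)`, `k > 0`, does not vanish. -/
def semistableLocus (n : ℕ) (ι : Type*) [Fintype ι] : Set (ι → ProjSpace n) :=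
  {x | ∃ k : ℕ, 0 < k ∧ ∃ f : MvPolynomial (ι × Fin (n + 1)) ℂ,
    IsMultihomogeneous f (fun _ => k) ∧ IsSLInvariant f ∧ ¬ VanishesAt f x}

/-- GIT stability of a configuration: it is semistable, its orbit is closed in the semistable
locus, and its stabilizer is finite. -/
def IsStableConfiguration (x : ι → ProjSpace n) : Prop :=
  x ∈ semistableLocus n ι ∧
  zariskiClosure (MulAction.orbit SL(n + 1, ℂ) x) ∩ semistableLocus n ι ⊆
    MulAction.orbit SL(n + 1, ℂ) x ∧
  Finite (MulAction.stabilizer SL(n + 1, ℂ) x)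

end GIT

/-- A finite point set is GIT stable if the configuration of its points, indexed by the set itself,
is stable. (The linearization is symmetric, so the labelling of the points is irrelevant.) -/
def IsGITStable {n : ℕ} (D : Finset (ProjSpace n)) : Prop :=
  IsStableConfiguration (fun p : D => (p : ProjSpace n))

/-! ### Balanced point sets -/

/-- The matrix `z_i z̄_j / |z|²` at a point `[z]` of `ℙⁿ`. -/
def pointMatrix {n : ℕ} (p : ProjSpace n) : Matrix (Fin (n + 1)) (Fin (n + 1)) ℂ :=
  Matrix.of fun i j => p.rep i * conj (p.rep j) / ((∑ k, ‖p.rep k‖ ^ 2 : ℝ) : ℂ)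

/-- `pointMatrix` does not depend on the representative. -/
theorem pointMatrix_mk {n : ℕ} (v : Fin (n + 1) → ℂ) (hv : v ≠ 0) (i j : Fin (n + 1)) :
    pointMatrix (Projectivization.mk ℂ v hv) i j =
      v i * conj (v j) / ((∑ k, ‖v k‖ ^ 2 : ℝ) : ℂ) := by
  obtain ⟨a, ha⟩ := Projectivization.exists_smul_eq_mk_rep ℂ v hv
  have ha0 : (a : ℂ) * conj (a : ℂ) ≠ 0 := by simp
  have h1 : ∀ k, (Projectivization.mk ℂ v hv).rep k = (a : ℂ) * v k := by
    intro k
    rw [← ha]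
    rfl
  have h2 : ((∑ k, ‖(a : ℂ) * v k‖ ^ 2 : ℝ) : ℂ) =
      ((a : ℂ) * conj (a : ℂ)) * ((∑ k, ‖v k‖ ^ 2 : ℝ) : ℂ) := by
    rw [Complex.mul_conj, Complex.normSq_eq_norm_sq, ← Complex.ofReal_mul, Finset.mul_sum]
    simp [mul_pow]
  simp only [pointMatrix, Matrix.of_apply, h1]
  rw [h2, map_mul, mul_mul_mul_comm, mul_div_mul_left _ _ ha0]

/-- The moment-map matrix `∫_D z_i z̄_j / |z|²` of a finite point set, the integral being the sum
over the points. -/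
def momentMatrix {n : ℕ} (D : Finset (ProjSpace n)) : Matrix (Fin (n + 1)) (Fin (n + 1)) ℂ :=
  ∑ p ∈ D, pointMatrix p

/-- `D` is balanced if its moment-map matrix is scalar. -/
def IsBalanced {n : ℕ} (D : Finset (ProjSpace n)) : Prop :=
  ∃ c : ℂ, momentMatrix D = c • (1 : Matrix (Fin (n + 1)) (Fin (n + 1)) ℂ)

/-- `D` admits a balanced embedding if some projective translate of it is balanced. -/
def AdmitsBalancedEmbedding {n : ℕ} (D : Finset (ProjSpace n)) : Prop :=
  ∃ g : GL (Fin (n + 1)) ℂ, IsBalanced (translate g D)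

/-- The point `v_b = [1 : ζ^b : ζ^{2b} : ⋯ : ζ^{nb}]` with `ζ = e^{2πi/(n+2)}`. -/
def rootPoint (n b : ℕ) : ProjSpace n :=
  Projectivization.mk ℂ
    (fun a : Fin (n + 1) => Complex.exp (2 * Real.pi * Complex.I / (n + 2)) ^ ((a : ℕ) * b))
    (fun h => by simpa using congrFun h 0)

end PointSets

end

open PointSets Matrix

namespace PointSets

variable {n : ℕ} {ι : Type*}

/-! Any n + 2 points in general position form a projective frame, so the group acts transitively on
such configurations, and only scalars fix one (`IsGeneral.exists_smul_stdFrame`,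
`eq_smul_one_of_smul_stdFrame`). Rescaling a matrix to determinant 1 shows that they form a single
`SL` orbit with finite stabilizers.

Semistability of n + 2 points is equivalent to general position: a product of maximal minors gives
one direction, a destabilizing one-parameter subgroup the other. The semistable locus is therefore
one orbit, which is trivially closed in it. For balance, transitivity moves D onto the root-of-unity
points, where the moment matrix is a table of geometric sums. -/

/-- A configuration of points of `ℙⁿ` is general if any `n + 1` of them are linearly
independent. -/
def IsGeneral (x : ι → ProjSpace n) : Prop :=
  ∀ σ : Fin (n + 1) ↪ ι, (Matrix.of fun a => (x (σ a)).rep).det ≠ 0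

theorem InGeneralPosition.isGeneral {D : Finset (ProjSpace n)} (hD : InGeneralPosition D) :
    IsGeneral (fun p : D => (p : ProjSpace n)) := by
  classical
  intro σ
  have hinj : Function.Injective fun a => (σ a : ProjSpace n) :=
    Subtype.val_injective.comp σ.injective
  have h := hD (Finset.univ.image fun a => (σ a : ProjSpace n))
    (by
      intro p hp
      obtain ⟨a, -, rfl⟩ := Finset.mem_image.mp hp
      exact (σ a).2)
    (by rw [Finset.card_image_of_injective _ hinj, Finset.card_fin])
  rw [Projectivization.independent_iff] at h
  have h2 := h.comp (fun a => (⟨σ a, Finset.mem_image_of_mem _ (Finset.mem_univ a)⟩ :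
      (Finset.univ.image fun a => (σ a : ProjSpace n) : Finset (ProjSpace n))))
    (fun a b hab => hinj (Subtype.mk.inj hab))
  have h3 : LinearIndependent ℂ (Matrix.of fun a => (σ a : ProjSpace n).rep).row := h2
  rw [linearIndependent_rows_iff_isUnit, isUnit_iff_isUnit_det] at h3
  exact h3.ne_zero

theorem IsGeneral.comp {κ : Type*} {x : ι → ProjSpace n} (hx : IsGeneral x) {e : κ → ι}
    (he : Function.Injective e) : IsGeneral (x ∘ e) :=
  fun σ => hx (σ.trans ⟨e, he⟩)

theorem isGeneral_mk {v : ι → Fin (n + 1) → ℂ} (hv : ∀ i, v i ≠ 0)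
    (h : ∀ σ : Fin (n + 1) ↪ ι, (Matrix.of fun a => v (σ a)).det ≠ 0) :
    IsGeneral fun i => Projectivization.mk ℂ (v i) (hv i) := by
  intro σ
  choose a ha using fun i => Projectivization.exists_smul_eq_mk_rep ℂ (v i) (hv i)
  have : (Matrix.of fun b => (Projectivization.mk ℂ (v (σ b)) (hv (σ b))).rep) =
      diagonal (fun b => (a (σ b) : ℂ)) * Matrix.of fun b => v (σ b) := by
    ext b c
    rw [diagonal_mul, Matrix.of_apply, ← ha]
    rfl
  rw [this, det_mul, det_diagonal]
  exact mul_ne_zero (Finset.prod_ne_zero_iff.mpr fun b _ => (a (σ b)).ne_zero) (h σ)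

/-! ### The standard projective frame -/

/-- The coordinate points together with the unit point `[1 : ⋯ : 1]`. -/
noncomputable def stdFrame (n : ℕ) : Option (Fin (n + 1)) → ProjSpace n
  | none => Projectivization.mk ℂ (fun _ => 1) (fun h => one_ne_zero (congrFun h 0))
  | some j => Projectivization.mk ℂ (Pi.single j 1) (by simp)

theorem smul_mk_eq_iff (g : GL (Fin (n + 1)) ℂ) {v : Fin (n + 1) → ℂ} (hv : v ≠ 0)
    (p : ProjSpace n) :
    g • Projectivization.mk ℂ v hv = p ↔ ∃ c : ℂ, c • p.rep = g.1 *ᵥ v := by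
  conv_lhs => rw [← p.mk_rep]
  rw [Projectivization.smul_mk, Projectivization.mk_eq_mk_iff']
  rfl

theorem IsGeneral.exists_smul_stdFrame {x : Option (Fin (n + 1)) → ProjSpace n}
    (hx : IsGeneral x) : ∃ g : GL (Fin (n + 1)) ℂ, g • stdFrame n = x := by
  set V : Matrix (Fin (n + 1)) (Fin (n + 1)) ℂ := Matrix.of fun j => (x (some j)).rep with hV
  have hdet : V.det ≠ 0 := hx ⟨some, Option.some_injective _⟩
  set a : Fin (n + 1) → ℂ := (x none).rep ᵥ* V⁻¹ with ha
  have haV : a ᵥ* V = (x none).rep := by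
    rw [ha, vecMul_vecMul, nonsing_inv_mul _ (isUnit_iff_ne_zero.mpr hdet), vecMul_one]
  have ha0 : ∀ j, a j ≠ 0 := by
    intro j hj
    -- Replacing the `j`-th row of `V` by the last point multiplies the determinant by `a j`, so `a
    -- j = 0` would make n + 1 of the points dependent.
    refine hx ⟨fun k => if k = j then none else some k, ?_⟩ ?_
    · intro k l hkl
      by_cases hk : k = j <;> by_cases hl : l = j <;> simp_all
    · have h1 : (Matrix.of fun k => (x (if k = j then none else some k)).rep) =
          V.updateRow j (∑ k, a k • V k) := by
        ext k l
        by_cases hk : k = j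
        · subst hk
          have := congrFun haV l
          simp only [vecMul, dotProduct] at this
          simp [this.symm]
        · simp [hk, hV]
      have h2 := det_updateRow_sum V j a
      rw [hj, zero_smul] at h2
      exact (congrArg Matrix.det h1).trans h2
  refine ⟨GeneralLinearGroup.mkOfDetNeZero (diagonal a * V)ᵀ ?_, ?_⟩
  · rw [det_transpose, det_mul, det_diagonal]
    exact mul_ne_zero (Finset.prod_ne_zero_iff.mpr fun j _ => ha0 j) hdet
  · funext o
    cases o with
    | none =>
      refine (smul_mk_eq_iff _ _ _).mpr ⟨1, ?_⟩
      change _ = (diagonal a * V)ᵀ *ᵥ _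
      rw [one_smul, ← haV, mulVec_transpose, ← vecMul_vecMul]
      congr 1
      ext j
      simp [vecMul_diagonal]
    | some j =>
      refine (smul_mk_eq_iff _ _ _).mpr ⟨a j, ?_⟩
      change _ = (diagonal a * V)ᵀ *ᵥ _
      ext k
      simp [hV, mul_comm]

theorem eq_smul_one_of_smul_stdFrame {g : GL (Fin (n + 1)) ℂ}
    (hg : g • stdFrame n = stdFrame n) :
    ∃ c : ℂ, g.1 = c • (1 : Matrix (Fin (n + 1)) (Fin (n + 1)) ℂ) := by
  have h1 : ∀ j, ∃ c : ℂ, c • (Pi.single j 1 : Fin (n + 1) → ℂ) = g.1 *ᵥ Pi.single j 1 :=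
    fun j => (Projectivization.mk_eq_mk_iff' ℂ _ _ _ _).mp (congrFun hg (some j))
  obtain ⟨c, hc⟩ : ∃ c : ℂ, c • (fun _ => 1 : Fin (n + 1) → ℂ) = g.1 *ᵥ fun _ => 1 :=
    (Projectivization.mk_eq_mk_iff' ℂ _ _ _ _).mp (congrFun hg none)
  choose b hb using h1
  have hgb : g.1 = diagonal b := by
    ext k j
    have := congrFun (hb j) k
    rw [mulVec_single_one] at this
    rw [← col_apply g.1, ← this, diagonal_apply]
    by_cases h : k = j
    · subst h; simp
    · simp [h]
  refine ⟨c, ?_⟩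
  rw [hgb, smul_one_eq_diagonal]
  congr 1
  ext j
  have := congrFun hc j
  rw [hgb, mulVec_diagonal] at this
  simpa using this.symm

/-! ### Orbits and stabilizers of general configurations -/

variable [Fintype ι]

theorem exists_smul_eq_of_isGeneral (hι : Fintype.card ι = n + 2) {x y : ι → ProjSpace n}
    (hx : IsGeneral x) (hy : IsGeneral y) : ∃ g : GL (Fin (n + 1)) ℂ, g • x = y := by
  obtain ⟨e⟩ : Nonempty (Option (Fin (n + 1)) ≃ ι) := by
    rw [← Fintype.card_eq]; simp [hι]
  obtain ⟨A, hA⟩ := (hx.comp e.injective).exists_smul_stdFrame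
  obtain ⟨B, hB⟩ := (hy.comp e.injective).exists_smul_stdFrame
  refine ⟨B * A⁻¹, funext fun i => ?_⟩
  have h1 := congrFun hA (e.symm i)
  have h2 := congrFun hB (e.symm i)
  simp only [Pi.smul_apply, Function.comp_apply, Equiv.apply_symm_apply] at h1 h2
  rw [Pi.smul_apply, ← h1, ← h2, mul_smul, inv_smul_smul]

theorem exists_SL_smul_eq (g : GL (Fin (n + 1)) ℂ) :
    ∃ h : SL(n + 1, ℂ), ∀ p : ProjSpace n, h • p = g • p := by
  obtain ⟨c, hc⟩ := IsAlgClosed.exists_pow_nat_eq (g.1.det)⁻¹ n.succ_pos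
  have hdet : g.1.det ≠ 0 := g.det.ne_zero
  have h1 : (c • g.1).det = 1 := by
    rw [det_smul, Fintype.card_fin, hc, inv_mul_cancel₀ hdet]
  let h : SL(n + 1, ℂ) := ⟨c • g.1, h1⟩
  refine ⟨h, fun p => ?_⟩
  · induction p using Projectivization.ind with
    | h v hv =>
      rw [Projectivization.smul_mk, Projectivization.smul_mk, Projectivization.mk_eq_mk_iff']
      exact ⟨c, (smul_mulVec c g.1 v).symm⟩

theorem IsGeneral.mem_orbit (hι : Fintype.card ι = n + 2) {x y : ι → ProjSpace n}
    (hx : IsGeneral x) (hy : IsGeneral y) : y ∈ MulAction.orbit SL(n + 1, ℂ) x := by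
  obtain ⟨g, rfl⟩ := exists_smul_eq_of_isGeneral hι hx hy
  obtain ⟨h, hh⟩ := exists_SL_smul_eq g
  exact ⟨h, funext fun i => hh (x i)⟩

/-- After conjugation to the standard frame a stabilizing matrix is scalar, and determinant 1 makes
the scalar an (n+1)-st root of unity. -/
theorem IsGeneral.finite_stabilizer (hι : Fintype.card ι = n + 2) {x : ι → ProjSpace n}
    (hx : IsGeneral x) : Finite (MulAction.stabilizer SL(n + 1, ℂ) x) := by
  obtain ⟨e⟩ : Nonempty (Option (Fin (n + 1)) ≃ ι) := by
    rw [← Fintype.card_eq]; simp [hι]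
  obtain ⟨A, hA⟩ := (hx.comp e.injective).exists_smul_stdFrame
  have key : ∀ g : MulAction.stabilizer SL(n + 1, ℂ) x, ∃ c : ℂ,
      g.1.1 = c • (1 : Matrix (Fin (n + 1)) (Fin (n + 1)) ℂ) := by
    rintro ⟨g, hg⟩
    have h1 : (A⁻¹ * (g : GL (Fin (n + 1)) ℂ) * A) • stdFrame n = stdFrame n := by
      have h2 : (g : GL (Fin (n + 1)) ℂ) • (x ∘ e) = x ∘ e :=
        funext fun o => congrFun hg (e o)
      rw [mul_smul, hA, mul_smul, h2, ← hA, inv_smul_smul]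
    obtain ⟨c, hc⟩ := eq_smul_one_of_smul_stdFrame h1
    refine ⟨c, ?_⟩
    have h3 : (g : GL (Fin (n + 1)) ℂ) = A * (A⁻¹ * (g : GL (Fin (n + 1)) ℂ) * A) * A⁻¹ := by
      group
    have h4 := congrArg Units.val h3
    rw [Units.val_mul, Units.val_mul, hc, mul_smul_comm, smul_mul_assoc, mul_one,
      ← Units.val_mul, mul_inv_cancel, Units.val_one] at h4
    exact h4
  choose c hc using key
  have hpow : ∀ g, c g ∈ {z : ℂ | z ^ (n + 1) = 1} := by
    intro g
    have := g.1.2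
    rw [hc, det_smul, det_one, mul_one, Fintype.card_fin] at this
    exact this
  have hfin : Finite {z : ℂ | z ^ (n + 1) = 1} := by
    refine (Set.Finite.subset (Polynomial.nthRoots (n + 1) (1 : ℂ)).toFinset.finite_toSet
      fun z hz => ?_).to_subtype
    simpa [Polynomial.mem_nthRoots n.succ_pos] using hz
  refine Finite.of_injective (fun g => (⟨c g, hpow g⟩ : {z : ℂ | z ^ (n + 1) = 1})) ?_
  intro g h hgh
  have h1 : c g = c h := congrArg Subtype.val hgh
  exact Subtype.ext (Subtype.ext (by rw [hc, hc, h1]))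

/-! ### Semistability -/

/-- The invariant is the product over `i` of the determinant of all points but the `i`-th. Each
point occurs in n + 1 factors, whence the degree k = n + 1. -/
theorem IsGeneral.mem_semistableLocus (hι : Fintype.card ι = n + 2) {x : ι → ProjSpace n}
    (hx : IsGeneral x) : x ∈ semistableLocus n ι := by
  classical
  have hcard : ∀ i : ι, Fintype.card {j // j ≠ i} = n + 1 := fun i => by simp [hι]
  let σ : ∀ i : ι, Fin (n + 1) ≃ {j // j ≠ i} := fun i =>
    (Fintype.equivFinOfCardEq (hcard i)).symm
  let F : MvPolynomial (ι × Fin (n + 1)) ℂ := ∏ i, Matrix.det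
    (Matrix.of fun a b : Fin (n + 1) => MvPolynomial.X ((σ i a : ι), b))
  have hF : ∀ v : ι × Fin (n + 1) → ℂ, MvPolynomial.eval v F =
      ∏ i, (Matrix.of fun a b : Fin (n + 1) => v ((σ i a : ι), b)).det := by
    intro v
    simp only [F, map_prod, RingHom.map_det]
    refine Finset.prod_congr rfl fun i _ => congrArg Matrix.det ?_
    ext a b
    simp
  refine ⟨n + 1, n.succ_pos, F, ?_, ?_, ?_⟩
  · intro t v
    rw [hF, hF]
    have h1 : ∀ i, (Matrix.of fun a b : Fin (n + 1) => t (σ i a) * v ((σ i a : ι), b)).det =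
        (∏ a, t (σ i a)) * (Matrix.of fun a b : Fin (n + 1) => v ((σ i a : ι), b)).det := by
      intro i
      rw [← det_diagonal, ← det_mul]
      congr 1
      ext a b
      simp [diagonal_mul]
    simp only [h1, Finset.prod_mul_distrib]
    congr 1
    have h2 : ∀ i, ∏ a, t (σ i a) = ∏ j, if j ≠ i then t j else 1 := by
      intro i
      rw [Equiv.prod_comp (σ i) fun j => t j, ← Finset.prod_filter,
        Finset.prod_subtype (p := fun j => j ≠ i) _ (by simp)]
    simp only [h2]
    rw [Finset.prod_comm]
    refine Finset.prod_congr rfl fun j _ => ?_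
    rw [← Finset.prod_filter, Finset.prod_const, Finset.filter_ne,
      Finset.card_erase_of_mem (Finset.mem_univ j), Finset.card_univ, hι]
    rfl
  · intro g v
    rw [hF, hF]
    refine Finset.prod_congr rfl fun i _ => ?_
    have : (Matrix.of fun a b : Fin (n + 1) => (g • v (σ i a)) b) =
        (Matrix.of fun a b : Fin (n + 1) => v (σ i a) b) * g.1ᵀ := by
      ext a b
      change (g.1 *ᵥ v (σ i a)) b = _
      simp [mul_apply, mulVec, dotProduct, mul_comm]
    rw [this, det_mul, det_transpose, g.2, mul_one]
  · unfold VanishesAt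
    rw [hF]
    exact Finset.prod_ne_zero_iff.mpr fun i _ =>
      hx ((σ i).toEmbedding.trans (Function.Embedding.subtype _))

/-- The one-parameter subgroup scaling the hyperplane `ker ℓ` by `t` and the complementary line
spanned by `w` by `t⁻ⁿ`. -/
theorem exists_SL_scaling {l w : Fin (n + 1) → ℂ} (hlw : l ⬝ᵥ w = 1) {t : ℂ} (ht : t ≠ 0) :
    ∃ g : SL(n + 1, ℂ), ∀ v : Fin (n + 1) → ℂ,
      g • v = t • v + (t * ((t ^ (n + 1))⁻¹ - 1) * (l ⬝ᵥ v)) • w := by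
  set A : Matrix (Fin (n + 1)) (Fin (n + 1)) ℂ :=
    t • (1 + replicateCol Unit (((t ^ (n + 1))⁻¹ - 1) • w) * replicateRow Unit l) with hA
  have hdet : A.det = 1 := by
    rw [hA, det_smul, det_one_add_replicateCol_mul_replicateRow, Fintype.card_fin,
      dotProduct_smul, hlw, smul_eq_mul, mul_one, add_sub_cancel,
      mul_inv_cancel₀ (pow_ne_zero _ ht)]
  let g : SL(n + 1, ℂ) := ⟨A, hdet⟩
  refine ⟨g, fun v => ?_⟩
  change A *ᵥ v = _
  rw [hA, smul_mulVec, add_mulVec, one_mulVec, ← vecMulVec_eq, vecMulVec_mulVec]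
  ext k
  simp
  ring

/-- Hilbert–Mumford argument: if n + 1 points lie on a hyperplane `ker l`, scaling it by t and a
complement by t⁻ⁿ gives f(y) = tᵏ f(u t) with `u` polynomial in t. Letting t → 0 forces f(y) = 0. -/
theorem isGeneral_of_mem_semistableLocus (hι : Fintype.card ι = n + 2) {y : ι → ProjSpace n}
    (hy : y ∈ semistableLocus n ι) : IsGeneral y := by
  classical
  obtain ⟨k, hk, f, hf, hinv, hne⟩ := hy
  intro σ hdet
  obtain ⟨l, hl0, hl⟩ := exists_mulVec_eq_zero_iff.mpr hdet
  obtain ⟨b, hb⟩ := Function.ne_iff.mp hl0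
  have hlw : l ⬝ᵥ Pi.single b (l b)⁻¹ = 1 := by
    rw [dotProduct_single]
    exact mul_inv_cancel₀ hb
  set w : Fin (n + 1) → ℂ := Pi.single b (l b)⁻¹
  obtain ⟨i, hi⟩ : ∃ i, ∀ j, j ≠ i → j ∈ Set.range σ := by
    have h1 : (Finset.univ.map σ)ᶜ.card = 1 := by
      rw [Finset.card_compl, Finset.card_map, Finset.card_fin, hι]
      omega
    obtain ⟨i, hi⟩ := Finset.card_eq_one.mp h1
    refine ⟨i, fun j hj => ?_⟩
    by_contra hcon
    have : j ∈ (Finset.univ.map σ)ᶜ := by simpa using hcon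
    rw [hi, Finset.mem_singleton] at this
    exact hj this
  have hlv : ∀ j, j ≠ i → l ⬝ᵥ (y j).rep = 0 := by
    intro j hj
    obtain ⟨a, rfl⟩ := hi j hj
    rw [dotProduct_comm]
    exact congrFun hl a
  -- The moved configuration with the factors t and, at `i`, t⁻ⁿ removed, so that it extends to t =
  -- 0.
  let u : ℂ → ι × Fin (n + 1) → ℂ := fun t p =>
    if p.1 = i then t ^ (n + 1) * (y i).rep p.2 + (1 - t ^ (n + 1)) * (l ⬝ᵥ (y i).rep) * w p.2
    else (y p.1).rep p.2
  have key : ∀ t : ℂ, t ≠ 0 → MvPolynomial.eval (fun p => (y p.1).rep p.2) f =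
      t ^ k * MvPolynomial.eval (u t) f := by
    intro t ht
    obtain ⟨g, hg⟩ := exists_SL_scaling hlw ht
    rw [← hinv g fun j => (y j).rep]
    have h1 : (fun p : ι × Fin (n + 1) => (g • (y p.1).rep) p.2) =
        fun p => (if p.1 = i then (t ^ n)⁻¹ else t) * u t p := by
      funext ⟨j, a⟩
      rw [hg]
      by_cases hj : j = i
      · subst hj
        simp only [u, if_true, Pi.add_apply, Pi.smul_apply, smul_eq_mul]
        field_simp
        ring
      · simp [u, hj, hlv j hj]
    rw [h1, hf (fun j => if j = i then (t ^ n)⁻¹ else t)]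
    congr 1
    -- The total weight is t⁻ⁿᵏ from the point `i` and tᵏ from each of the n + 1 others, leaving tᵏ.
    rw [← Finset.mul_prod_erase _ _ (Finset.mem_univ i), if_pos rfl,
      Finset.prod_congr rfl (g := fun _ => t ^ k)
        (fun j hj => by rw [if_neg (Finset.ne_of_mem_erase hj)]),
      Finset.prod_const, Finset.card_erase_of_mem (Finset.mem_univ i), Finset.card_univ, hι]
    have h2 : n + 2 - 1 = n + 1 := rfl
    rw [h2, pow_succ (t ^ k) n, ← mul_assoc, inv_pow, ← pow_mul, ← pow_mul, mul_comm n k,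
      inv_mul_cancel₀ (pow_ne_zero _ ht), one_mul]
  have hcont : Continuous fun t : ℂ => t ^ k * MvPolynomial.eval (u t) f := by
    refine (continuous_pow k).mul ((MvPolynomial.continuous_eval f).comp ?_)
    refine continuous_pi fun p => ?_
    by_cases hp : p.1 = i
    · simp only [u, hp, if_true]
      fun_prop
    · simp only [u, hp, if_false]
      fun_prop
  have hconst : (fun t : ℂ => t ^ k * MvPolynomial.eval (u t) f) =
      fun _ => MvPolynomial.eval (fun p => (y p.1).rep p.2) f :=
    Continuous.ext_on (dense_compl_singleton (0 : ℂ)) hcont continuous_const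
      fun t ht => (key t ht).symm
  have h0 := congrFun hconst 0
  rw [zero_pow hk.ne', zero_mul] at h0
  exact hne h0.symm

theorem IsGeneral.isStableConfiguration (hι : Fintype.card ι = n + 2) {x : ι → ProjSpace n}
    (hx : IsGeneral x) : IsStableConfiguration x :=
  ⟨hx.mem_semistableLocus hι,
    fun _ hy => hx.mem_orbit hι (isGeneral_of_mem_semistableLocus hι hy.2),
    hx.finite_stabilizer hι⟩

/-! ### Points given by roots of unity -/

theorem isPrimitiveRoot_exp_add_two (n : ℕ) :
    IsPrimitiveRoot (Complex.exp (2 * Real.pi * Complex.I / (n + 2))) (n + 2) := by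
  have := Complex.isPrimitiveRoot_exp (n + 2) (by omega)
  push_cast at this
  exact this

/-- Any n + 1 of the points give a Vandermonde matrix with distinct nodes. -/
theorem isGeneral_rootPoint (n : ℕ) :
    IsGeneral fun b : Fin (n + 2) => rootPoint n b := by
  refine isGeneral_mk _ fun σ => ?_
  have h : (Matrix.of fun (a : Fin (n + 1)) (j : Fin (n + 1)) =>
      Complex.exp (2 * Real.pi * Complex.I / (n + 2)) ^ ((j : ℕ) * (σ a : ℕ))) =
      vandermonde fun a =>
        Complex.exp (2 * Real.pi * Complex.I / (n + 2)) ^ (σ a : ℕ) := by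
    ext a j
    rw [vandermonde_apply, ← pow_mul, Matrix.of_apply, mul_comm (j : ℕ)]
  rw [h, det_vandermonde_ne_zero_iff]
  intro a b hab
  exact σ.injective (Fin.ext
    ((isPrimitiveRoot_exp_add_two n).pow_inj (σ a).isLt (σ b).isLt hab))

/-- Entry (i, j) is 1/(n+1) times the sum of the powers of ζ^(i-j) over a full period; it vanishes
off the diagonal because i, j ≤ n keeps ζ^(i-j) ≠ 1. -/
theorem sum_pointMatrix_rootPoint (n : ℕ) :
    ∑ b : Fin (n + 2), pointMatrix (rootPoint n b) =
      (((n : ℂ) + 2) / ((n : ℂ) + 1)) • (1 : Matrix (Fin (n + 1)) (Fin (n + 1)) ℂ) := by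
  have hζ := isPrimitiveRoot_exp_add_two n
  set ζ := Complex.exp (2 * Real.pi * Complex.I / (n + 2)) with hζdef
  have hnorm : ‖ζ‖ = 1 := hζ.norm'_eq_one (by omega)
  have hζ0 : ζ ≠ 0 := hζ.ne_zero (by omega)
  have hconj : conj ζ = ζ⁻¹ := (Complex.inv_eq_conj hnorm).symm
  ext i j
  have h1 : ∀ b : Fin (n + 2), pointMatrix (rootPoint n b) i j =
      (ζ ^ (i : ℕ) * ζ⁻¹ ^ (j : ℕ)) ^ (b : ℕ) / ((n : ℂ) + 1) := by
    intro b
    rw [rootPoint, pointMatrix_mk, ← hζdef, map_pow, hconj, mul_pow, ← pow_mul, ← pow_mul]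
    simp [hnorm]
  rw [Matrix.sum_apply]
  simp only [h1]
  rw [← Finset.sum_div, Fin.sum_univ_eq_sum_range
    (fun b => (ζ ^ (i : ℕ) * ζ⁻¹ ^ (j : ℕ)) ^ b), Matrix.smul_apply, smul_eq_mul]
  by_cases hij : i = j
  · subst hij
    rw [← mul_pow, mul_inv_cancel₀ hζ0]
    simp
  · rw [one_apply_ne hij, mul_zero]
    set q := ζ ^ (i : ℕ) * ζ⁻¹ ^ (j : ℕ)
    have hq1 : q ≠ 1 := by
      intro hq
      apply hij
      refine Fin.ext (hζ.pow_inj (by omega) (by omega) ?_)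
      rwa [show q = ζ ^ (i : ℕ) * ζ⁻¹ ^ (j : ℕ) from rfl, inv_pow, ← div_eq_mul_inv, div_eq_one_iff_eq (pow_ne_zero _ hζ0)] at hq
    have hqn : q ^ (n + 2) = 1 := by
      rw [mul_pow, ← pow_mul, ← pow_mul, mul_comm (i : ℕ), mul_comm (j : ℕ), pow_mul, pow_mul,
        inv_pow ζ (n + 2), hζ.pow_eq_one]
      simp
    rw [geom_sum_eq hq1, hqn, sub_self, zero_div, zero_div]

end PointSets

theorem mainTheorem2 (n : ℕ) (D : Finset (PointSets.ProjSpace n)) (hcard : D.card = n + 2)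
    (hD : PointSets.InGeneralPosition D) :
    PointSets.IsGITStable D ∧
    PointSets.AdmitsBalancedEmbedding D ∧
    ∃ g : Matrix.GeneralLinearGroup (Fin (n + 1)) ℂ,
      (PointSets.translate g D : Set (PointSets.ProjSpace n)) =
        Set.range (fun b : Fin (n + 2) => PointSets.rootPoint n b) ∧
      PointSets.momentMatrix (PointSets.translate g D) =
        (((n : ℂ) + 2) / ((n : ℂ) + 1)) • (1 : Matrix (Fin (n + 1)) (Fin (n + 1)) ℂ) := by
  have hι : Fintype.card D = n + 2 := by rw [Fintype.card_coe, hcard]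
  let e : D ≃ Fin (n + 2) := Fintype.equivFinOfCardEq hι
  obtain ⟨g, hg⟩ := exists_smul_eq_of_isGeneral hι hD.isGeneral
    ((isGeneral_rootPoint n).comp e.injective)
  have hge : ∀ p : D, g • (p : ProjSpace n) = rootPoint n (e p) := fun p => congrFun hg p
  have hmoment : momentMatrix (PointSets.translate g D) =
      (((n : ℂ) + 2) / ((n : ℂ) + 1)) • (1 : Matrix (Fin (n + 1)) (Fin (n + 1)) ℂ) := by
    rw [momentMatrix, PointSets.translate, Finset.sum_map, ← Finset.sum_coe_sort,
      ← sum_pointMatrix_rootPoint, ← Equiv.sum_comp e]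
    exact Finset.sum_congr rfl fun p _ => congrArg pointMatrix (hge p)
  refine ⟨hD.isGeneral.isStableConfiguration hι, ⟨g, _, hmoment⟩, g, ?_, hmoment⟩
  ext p
  simp only [PointSets.translate, Finset.coe_map, Set.mem_image, Set.mem_range]
  constructor
  · rintro ⟨q, hq, rfl⟩
    exact ⟨e ⟨q, hq⟩, (hge ⟨q, hq⟩).symm⟩
  · rintro ⟨b, rfl⟩
    refine ⟨e.symm b, (e.symm b).2, ?_⟩
    rw [← e.apply_symm_apply b, Equiv.symm_apply_apply]
    exact hge _
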